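/- Let $d\in\{2,3\}$, let $k\ge 1$ be an integer and let $\sigma$ be a shape-regularity parameter. Setting. Let $\Omega\subset\mathbb{R}^d$ be a polygonal ($d=2$) or polyhedral ($d=3$) domain and let $\mathcal{T}$ be a finite conforming triangulation of $\Omega$ into $d$-simplices $K$ with diameter $h_K$ and outward unit normal $n$ on $\partial K$. Let $\mathcal F$ be the set of all facets. The triangulation is called $\sigma$-shape-regular if $h_K\le\sigma\rho_K$ for all $K\in\mathcal{T}$, where $\rho_K$ is the diameter of the largest ball contained in $K$. Let $V(K)=[P_k(K)]^d$ be the polynomial vector fields of degree at most $k$ on $K$, let $V_h$ be the space of vector fields $v_h$ on $\Omega$ with $v_h|_K\in V(K)$ for all $K\in\mathcal T$, and let $\bar V_h$ be the space of vector fields $\bar v_h$ on the union of all facets with $\bar v_h|_F\in[P_k(F)]^d$ for all $F\in\mathcal{F}$ and $\bar v_h=0$ on $\partial\Omega$. Write $(\cdot,\cdot)_K$ and $\langle\cdot,\cdot\rangle_{\partial K}$ for the $L^2$ inner products on $K$ and $\partial K$ (the latter with respect to surface measure), and $\|\cdot\|_{\partial K}$ for the norm of the latter. For $\alpha>0$ and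 $(w_h,\bar w_h),(v_h,\bar v_h)\in V_h\times\bar V_h$ put $$a_h((w_h,\bar w_h),(v_h,\bar v_h))=\sum_{K\in\mathcal{T}}\Big[(\nabla w_h,\nabla v_h)_K+\alpha h_K^{-1}\langle w_h-\bar w_h,v_h-\bar v_h\rangle_{\partial K}-\langle w_h-\bar w_h,\partial_n v_h\rangle_{\partial K}-\langle\partial_n w_h,v_h-\bar v_h\rangle_{\partial K}\Big].$$ For $\bar w_h\in\bar V_h$, the local solver lifting $l(\bar w_h)\in V_h$ is the function $v_h\in V_h$ such that for every $K\in\mathcal{T}$ and every $w\in V(K)$ $$(\nabla v_h,\nabla w)_K-\langle\partial_n v_h,w\rangle_{\partial K}-\langle v_h,\partial_n w\rangle_{\partial K}+\alpha h_K^{-1}\langle v_h,w\rangle_{\partial K}=-\langle\partial_n w,\bar w_h\rangle_{\partial K}+\alpha h_K^{-1}\langle w,\bar w_h\rangle_{\partial K}.$$ Put $\bar a_h(\bar v_h,\bar w_h)=a_h((l(\bar v_h),\bar v_h),(l(\bar w_h),\bar w_h))$ and $$|||\bar w_h|||_h^2=\sum_{K\in\mathcal{T}}h_K^{-1}\|\bar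 w_h-m_K(\bar w_h)\|_{\partial K}^2,\qquad m_K(\bar w_h)=\frac1{|\partial K|}\int_{\partial K}\bar w_h\,ds.$$ Claim. For every sufficiently large $\alpha$, namely for all $\alpha\ge\alpha_0$ with some $\alpha_0>0$ depending only on $d$, $k$ and $\sigma$, there are constants $C_1,C_2>0$, depending only on $d$, $k$, $\sigma$ and $\alpha$ (in particular independent of the mesh sizes $h_K$), such that for every such domain $\Omega$, every $\sigma$-shape-regular triangulation $\mathcal{T}$ of $\Omega$ and every $\bar w_h\in\bar V_h$, the lifting $l(\bar w_h)$ exists and is unique, and $$C_1\,|||\bar w_h|||_h^2\le\bar a_h(\bar w_h,\bar w_h)\le C_2\,|||\bar w_h|||_h^2 .$$ -/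

import Mathlib

open MeasureTheory

noncomputable section

namespace HDG

/-- The Euclidean space `ℝ^d`. -/
abbrev Euc (d : ℕ) : Type := EuclideanSpace ℝ (Fin d)

/-- A (bounded) polygonal (`d = 2`) or polyhedral (`d = 3`) domain: a nonempty connected open set
that is the interior of its closure, the closure being a finite union of convex polytopes. -/
structure IsPolytopalDomain {d : ℕ} (Ω : Set (Euc d)) : Prop where
  isOpen : IsOpen Ω
  isConnected : IsConnected Ω
  interior_closure : interior (closure Ω) = Ω
  exists_polytopes : ∃ S : Finset (Finset (Euc d)),
    closure Ω = ⋃ P ∈ S, convexHull ℝ (P : Set (Euc d))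

/-- A conforming triangulation of `Ω` into `d`-simplices: a finite simplicial complex (a simplex is
stored as its finite set of vertices) that covers `closure Ω` and in which every simplex is a face
of a `d`-dimensional one. -/
structure Triangulation {d : ℕ} (Ω : Set (Euc d)) extends
    Geometry.SimplicialComplex ℝ (Euc d) where
  finite_faces : faces.Finite
  isPure : ∀ s ∈ faces, ∃ K ∈ faces, s ⊆ K ∧ K.card = d + 1
  space_eq : toSimplicialComplex.space = closure Ω

namespace Triangulation

variable {d : ℕ} {Ω : Set (Euc d)}

/-- The set of cells `K`, each given by its `d + 1` vertices. -/
def cells (T : Triangulation Ω) : Finset (Finset (Euc d)) :=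
  {K ∈ T.finite_faces.toFinset | K.card = d + 1}

/-- The set of facets `F` (interior and boundary ones), each given by its `d` vertices. -/
def facets (T : Triangulation Ω) : Finset (Finset (Euc d)) :=
  {F ∈ T.finite_faces.toFinset | F.card = d}

open Classical in
/-- The facets that make up the boundary `∂K` of the cell `K`. -/
def facetsOf (T : Triangulation Ω) (K : T.cells) : Finset T.facets :=
  {F : T.facets | F.1 ⊆ K.1}

end Triangulation

section Geometry

variable {d : ℕ}

/-- The closed simplex with the given vertices. -/
def hull (s : Finset (Euc d)) : Set (Euc d) := convexHull ℝ (s : Set (Euc d))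

/-- The length measure `h_K` of a cell: its diameter. -/
def size (K : Finset (Euc d)) : ℝ := Metric.diam (hull K)

/-- The unit normal on the facet `F` of the cell `K` pointing out of `K`: the normalized component,
orthogonal to `F`, of the vector from the barycentre of `K` to the barycentre of `F`. -/
def outwardNormal (K F : Finset (Euc d)) : Euc d :=
  let ν : Euc d := (vectorSpan ℝ (F : Set (Euc d)))ᗮ.starProjection
    (F.centroid ℝ id - K.centroid ℝ id)
  ‖ν‖⁻¹ • ν

/-- `h_K ≤ σ ρ_K` for all cells `K`, where `ρ_K` is the diameter of the largest ball in `K`. -/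
def Triangulation.ShapeRegular {Ω : Set (Euc d)} (T : Triangulation Ω) (σ : ℝ) : Prop :=
  ∀ K ∈ T.cells, ∃ (c : Euc d) (r : ℝ), 0 < r ∧ Metric.closedBall c r ⊆ hull K ∧
    size K ≤ σ * (2 * r)

end Geometry

section Spaces

variable {d : ℕ} {Ω : Set (Euc d)}

/-- `f` coincides on `D` with a vector field whose `d` components are polynomials of total degree
at most `k`; that is, `f ∈ [P_k(D)]^d`. -/
def IsPolyOn (k : ℕ) (D : Set (Euc d)) (f : Euc d → Euc d) : Prop :=
  ∃ p : Fin d → MvPolynomial (Fin d) ℝ, (∀ i, (p i).totalDegree ≤ k) ∧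
    ∀ x ∈ D, ∀ i, f x i = MvPolynomial.eval (fun j => x j) (p i)

/-- The local space `V(K) = [P_k(K)]^d`. A polynomial on the (full-dimensional) cell `K` is
identified with its unique polynomial extension to `ℝ^d`, so that its trace and its normal
derivative on `∂K` are the values of the extension and of its derivative. -/
def localSpace (d k : ℕ) : Set (Euc d → Euc d) := {v | IsPolyOn k Set.univ v}

/-- The space `V_h` of cellwise polynomial vector fields, discontinuous across facets. -/
def cellSpace (T : Triangulation Ω) (k : ℕ) : Set (T.cells → Euc d → Euc d) :=
  {v | ∀ K, v K ∈ localSpace d k}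

/-- The space `V̄_h` of facetwise polynomial vector fields that vanish on `∂Ω`. The value of
`w F` away from the facet `F` is irrelevant. -/
def facetSpace (T : Triangulation Ω) (k : ℕ) : Set (T.facets → Euc d → Euc d) :=
  {w | (∀ F, IsPolyOn k (hull F.1) (w F)) ∧
    ∀ F, hull F.1 ⊆ frontier Ω → ∀ x ∈ hull F.1, w F x = 0}

end Spaces

section Forms

variable {d : ℕ} {Ω : Set (Euc d)} {T : Triangulation Ω}

/-- `(∇v, ∇w)_K`, with the Frobenius product of the gradients. -/
def gradInner (K : T.cells) (v w : Euc d → Euc d) : ℝ :=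
  ∫ x in hull K.1, ∑ j : Fin d,
    inner ℝ (fderiv ℝ v x (EuclideanSpace.single j 1)) (fderiv ℝ w x (EuclideanSpace.single j 1))

/-- `⟨f, g⟩_{∂K}` for functions `f`, `g` given facet by facet, with respect to the
`(d - 1)`-dimensional surface measure. -/
def bdryInner (K : T.cells) (f g : T.facets → Euc d → Euc d) : ℝ :=
  ∑ F ∈ T.facetsOf K, ∫ x in hull F.1, inner ℝ (f F x) (g F x) ∂μHE[d - 1]

/-- The trace of a function on the facets. -/
def trace (T : Triangulation Ω) (v : Euc d → Euc d) : T.facets → Euc d → Euc d := fun _ => v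

/-- The derivative `∂_n v = (∇v) n` along the outward unit normal of `K`. -/
def normalDeriv (K : T.cells) (v : Euc d → Euc d) : T.facets → Euc d → Euc d :=
  fun F x => fderiv ℝ v x (outwardNormal K.1 F.1)

/-- The mean `m_K(w)` of a facet function over `∂K`. -/
def bdryMean (K : T.cells) (w : T.facets → Euc d → Euc d) : Euc d :=
  (∑ F ∈ T.facetsOf K, (μHE[d - 1] : Measure (Euc d)).real (hull F.1))⁻¹ •
    ∑ F ∈ T.facetsOf K, ∫ x in hull F.1, w F x ∂μHE[d - 1]

/-- The square of the norm `|||w|||_h`: the sum over the cells of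
`h_K⁻¹ ‖w - m_K(w)‖²_{∂K}`. -/
def facetNormSq (T : Triangulation Ω) (w : T.facets → Euc d → Euc d) : ℝ :=
  ∑ K : T.cells, (size K.1)⁻¹ *
    bdryInner K (fun F x => w F x - bdryMean K w) (fun F x => w F x - bdryMean K w)

/-- The bilinear form `a_h((w, w̄), (v, v̄))`. -/
def formA (T : Triangulation Ω) (α : ℝ)
    (w v : (T.cells → Euc d → Euc d) × (T.facets → Euc d → Euc d)) : ℝ :=
  ∑ K : T.cells,
    (gradInner K (w.1 K) (v.1 K)
      + α * (size K.1)⁻¹ * bdryInner K (trace T (w.1 K) - w.2) (trace T (v.1 K) - v.2)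
      - bdryInner K (trace T (w.1 K) - w.2) (normalDeriv K (v.1 K))
      - bdryInner K (normalDeriv K (w.1 K)) (trace T (v.1 K) - v.2))

/-- The local bilinear form `a_K(v, w)`. -/
def localForm (α : ℝ) (K : T.cells) (v w : Euc d → Euc d) : ℝ :=
  gradInner K v w
    - bdryInner K (normalDeriv K v) (trace T w)
    - bdryInner K (trace T v) (normalDeriv K w)
    + α * (size K.1)⁻¹ * bdryInner K (trace T v) (trace T w)

/-- The local linear form `L_K(w)` for facet velocity data `m` (and zero pressure data and zero
body force). -/
def localLoad (α : ℝ) (K : T.cells) (m : T.facets → Euc d → Euc d) (w : Euc d → Euc d) : ℝ :=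
  - bdryInner K (normalDeriv K w) m + α * (size K.1)⁻¹ * bdryInner K (trace T w) m

/-- `v ∈ V_h` solves the local problems `a_K(v, w) = L_K(w)` for all `w ∈ V(K)`, on all cells `K`,
with facet velocity data `m`. -/
def IsLocalSolution (T : Triangulation Ω) (k : ℕ) (α : ℝ) (m : T.facets → Euc d → Euc d)
    (v : T.cells → Euc d → Euc d) : Prop :=
  v ∈ cellSpace T k ∧
    ∀ K : T.cells, ∀ w ∈ localSpace d k, localForm α K (v K) w = localLoad α K m w

/-- The local solver lifting `l(m)`: the solution of the local problems with facet velocity data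
`m` (an arbitrary function if there is none). -/
def localLift (T : Triangulation Ω) (k : ℕ) (α : ℝ) (m : T.facets → Euc d → Euc d) :
    T.cells → Euc d → Euc d :=
  Classical.epsilon (IsLocalSolution T k α m)

/-- The condensed form `ā_h(v̄, w̄) = a_h((l(v̄), v̄), (l(w̄), w̄))`. -/
def condensedForm (T : Triangulation Ω) (k : ℕ) (α : ℝ)
    (v w : T.facets → Euc d → Euc d) : ℝ :=
  formA T α (localLift T k α v, v) (localLift T k α w, w)

end Forms

end HDG

end

/-! The condensed form is a sum over the cells of the interior penalty energy of the pair (lifting,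
facet data), so both bounds are proved cell by cell. The inverse trace inequality ‖∂ₙv‖²_{∂K} ≤ C₀
h_K⁻¹ ‖∇v‖²_K lets a large α absorb the two consistency terms (`penalty_energy_lower_bound`). The
local problem is then coercive, hence uniquely solvable, and its solution minimizes the energy over
V(K) (`penalty_energy_le_of_solution`).

Upper bound: the constant m_K(w̄) is an admissible competitor. Its gradient vanishes, so its energy
is α h_K⁻¹ ‖w̄ - m_K(w̄)‖²_{∂K}.

Lower bound: the energy controls ‖∇v‖²_K and h_K⁻¹ ‖v - w̄‖²_{∂K}. Since m_K(w̄) is the best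
constant, it may be replaced by any c; then w̄ - c = (v - c) - (v - w̄), and a Poincaré inequality
on ∂K bounds v - c by the gradient.

Uniformity in the mesh comes from equivalence of norms on [P_k]^d over the unit ball, moved by
translation and scaling to a ball inscribed in K. Shape regularity puts K inside a fixed multiple of
that ball, so no affine map to a reference simplex is needed. -/

noncomputable section

namespace HDG

/-! ### Polynomial vector fields and the inverse inequality on balls. -/

section PolynomialFields

variable {d k : ℕ}

/-- Evaluation of the tuples of polynomials of total degree at most `k`, as vector fields. -/
def polyFieldMap (d k : ℕ) :
    (Fin d → MvPolynomial.restrictTotalDegree (Fin d) ℝ k) →ₗ[ℝ] (Euc d → Euc d) where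
  toFun p x := WithLp.toLp 2 fun i => MvPolynomial.eval (fun j => x j) (p i).1
  map_add' p q := by ext x i; simp
  map_smul' a p := by ext x i; simp

/-- The local space `[P_k]^d` as a submodule. -/
def polySpace (d k : ℕ) : Submodule ℝ (Euc d → Euc d) := LinearMap.range (polyFieldMap d k)

theorem mem_polySpace {v : Euc d → Euc d} : v ∈ polySpace d k ↔ v ∈ localSpace d k := by
  constructor
  · rintro ⟨p, rfl⟩
    exact ⟨fun i => (p i).1, fun i => (MvPolynomial.mem_restrictTotalDegree _ _ _).1 (p i).2,
      fun x _ i => rfl⟩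
  · rintro ⟨p, hp, h⟩
    refine ⟨fun i => ⟨p i, (MvPolynomial.mem_restrictTotalDegree _ _ _).2 (hp i)⟩, ?_⟩
    ext x i
    exact (h x trivial i).symm

instance : FiniteDimensional ℝ (polySpace d k) :=
  inferInstanceAs (FiniteDimensional ℝ (LinearMap.range (polyFieldMap d k)))

theorem const_mem_polySpace (c : Euc d) : (fun _ => c) ∈ polySpace d k :=
  mem_polySpace.2 ⟨fun i => MvPolynomial.C (c i), by simp, by simp⟩

theorem contDiff_of_mem_polySpace {v : Euc d → Euc d} (hv : v ∈ polySpace d k) (n : ℕ∞) :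
    ContDiff ℝ n v := by
  obtain ⟨p, -, hp⟩ := mem_polySpace.1 hv
  rw [contDiff_euclidean]
  intro i
  have h : (fun x => v x i) = fun x : Euc d => MvPolynomial.eval (fun j => x j) (p i) :=
    funext fun x => hp x trivial i
  rw [h, ← contDiffOn_univ]
  exact (AnalyticOnNhd.eval_linearMap'
    (fun j : Fin d => ((EuclideanSpace.proj j : Euc d →L[ℝ] ℝ) : Euc d →ₗ[ℝ] ℝ)) (p i)).contDiffOn
    uniqueDiffOn_univ

/-- Substituting polynomials of degree at most one does not increase the total degree. -/
theorem totalDegree_bind₁_le {ι τ : Type*} (p : MvPolynomial ι ℝ) (f : ι → MvPolynomial τ ℝ)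
    (hf : ∀ i, (f i).totalDegree ≤ 1) : (MvPolynomial.bind₁ f p).totalDegree ≤ p.totalDegree := by
  rw [MvPolynomial.bind₁, MvPolynomial.aeval_def, MvPolynomial.eval₂_eq]
  refine MvPolynomial.totalDegree_finsetSum_le fun s hs => ?_
  refine (MvPolynomial.totalDegree_mul _ _).trans ?_
  have h : (∏ i ∈ s.support, f i ^ s i).totalDegree ≤ s.sum fun _ e => e := by
    refine (MvPolynomial.totalDegree_finsetProd _ _).trans (Finset.sum_le_sum fun i _ => ?_)
    refine (MvPolynomial.totalDegree_pow _ _).trans ?_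
    simpa using Nat.mul_le_mul_left (s i) (hf i)
  have h' := MvPolynomial.le_totalDegree hs
  simp only [MvPolynomial.algebraMap_eq, MvPolynomial.totalDegree_C, zero_add]
  exact h.trans h'

theorem comp_affine_mem_polySpace {v : Euc d → Euc d} (hv : v ∈ polySpace d k) (c : Euc d)
    (r : ℝ) : (fun x => v (c + r • x)) ∈ polySpace d k := by
  obtain ⟨p, hp, h⟩ := mem_polySpace.1 hv
  refine mem_polySpace.2 ⟨fun i => MvPolynomial.bind₁
    (fun j => MvPolynomial.C (c j) + MvPolynomial.C r * MvPolynomial.X j) (p i), fun i => ?_,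
    fun x _ i => ?_⟩
  · refine (totalDegree_bind₁_le _ _ fun j => ?_).trans (hp i)
    refine (MvPolynomial.totalDegree_add _ _).trans (max_le (by simp) ?_)
    exact (MvPolynomial.totalDegree_mul _ _).trans (by simp)
  · rw [h _ trivial]
    change _ = MvPolynomial.eval₂Hom (RingHom.id ℝ) _ (MvPolynomial.bind₁ _ _)
    rw [MvPolynomial.eval₂Hom_bind₁, MvPolynomial.eval]
    congr 2
    funext j
    simp

/-- The directional derivatives of the fields in `[P_k]^d` belong to `[P_k]^d`. -/
theorem fderiv_mem_polySpace {v : Euc d → Euc d} (hv : v ∈ polySpace d k) (e : Euc d) :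
    (fun x => fderiv ℝ v x e) ∈ polySpace d k := by
  -- A finite-dimensional subspace is closed for pointwise convergence, and it contains the
  -- difference quotients.
  have hcl : IsClosed (polySpace d k : Set (Euc d → Euc d)) :=
    Submodule.closed_of_finiteDimensional _
  have hlim : Filter.Tendsto (fun (t : ℝ) (x : Euc d) => t⁻¹ • (v (x + t • e) - v x))
      (nhdsWithin 0 {0}ᶜ) (nhds fun x => fderiv ℝ v x e) := by
    refine tendsto_pi_nhds.2 fun x => ?_
    have hd := ((contDiff_of_mem_polySpace hv 1).differentiable (by simp) x).hasFDerivAt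
    exact (hd.hasLineDerivAt e).tendsto_slope_zero
  refine hcl.mem_of_tendsto hlim (Filter.Eventually.of_forall fun t => ?_)
  refine Submodule.smul_mem _ _ (Submodule.sub_mem _ ?_ hv)
  simpa [add_comm] using comp_affine_mem_polySpace hv (t • e) 1

/-- The identity theorem for analytic functions; it makes the L² norm over the unit ball definite on
[P_k]^d. -/
theorem eq_zero_of_eqOn_ball {v : Euc d → Euc d} (hv : v ∈ polySpace d k)
    (h : ∀ x ∈ Metric.ball (0 : Euc d) 1, v x = 0) : v = 0 := by
  obtain ⟨p, -, hp⟩ := mem_polySpace.1 hv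
  ext x i
  rw [hp x trivial i]
  have ha := AnalyticOnNhd.eval_linearMap'
    (fun j : Fin d => ((EuclideanSpace.proj j : Euc d →L[ℝ] ℝ) : Euc d →ₗ[ℝ] ℝ)) (p i)
  have := ha.eqOn_zero_of_preconnected_of_eventuallyEq_zero isPreconnected_univ
    (Set.mem_univ (0 : Euc d)) ?_
  · exact this (Set.mem_univ x)
  · filter_upwards [Metric.ball_mem_nhds (0 : Euc d) one_pos] with y hy
    exact (hp y trivial i).symm.trans (by rw [h y hy]; rfl)

theorem continuous_of_mem_polySpace {v : Euc d → Euc d} (hv : v ∈ polySpace d k) :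
    Continuous v := (contDiff_of_mem_polySpace hv 0).continuous

theorem memLp_of_mem_polySpace {v : Euc d → Euc d} (hv : v ∈ polySpace d k) :
    MemLp v 2 (volume.restrict (Metric.ball (0 : Euc d) 1)) := by
  have hc := continuous_of_mem_polySpace hv
  obtain ⟨C, hC⟩ := (isCompact_closedBall (0 : Euc d) 1).exists_bound_of_continuousOn
    hc.continuousOn
  have : IsFiniteMeasure (volume.restrict (Metric.ball (0 : Euc d) 1)) :=
    ⟨by simpa using measure_ball_lt_top⟩
  refine MemLp.of_bound hc.aestronglyMeasurable C ?_
  filter_upwards [ae_restrict_mem measurableSet_ball] with x hx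
  exact hC x (Metric.ball_subset_closedBall hx)

/-- On `[P_k]^d` the supremum over a ball of radius `R` is bounded by the `L²` norm over the unit
ball. -/
theorem exists_sup_le_integral_unitBall (d k : ℕ) (R : ℝ) :
    ∃ C : ℝ, 0 < C ∧ ∀ v ∈ polySpace d k, ∀ x ∈ Metric.closedBall (0 : Euc d) R,
      ‖v x‖ ^ 2 ≤ C * ∫ y in Metric.ball (0 : Euc d) 1, ‖v y‖ ^ 2 := by
  let μ : Measure (Euc d) := volume.restrict (Metric.ball (0 : Euc d) 1)
  let ι : polySpace d k →ₗ[ℝ] Lp (Euc d) 2 μ :=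
    { toFun := fun v => (memLp_of_mem_polySpace v.2).toLp v.1
      map_add' := fun v w => rfl
      map_smul' := fun a v => rfl }
  let S : polySpace d k →ₗ[ℝ] C(Metric.closedBall (0 : Euc d) R, Euc d) :=
    { toFun := fun v => ⟨fun x => v.1 x.1,
        (continuous_of_mem_polySpace v.2).comp continuous_subtype_val⟩
      map_add' := fun v w => rfl
      map_smul' := fun a v => rfl }
  have hι : Function.Injective ι := by
    rw [injective_iff_map_eq_zero]
    intro v hv
    have h0 : v.1 =ᵐ[μ] 0 := by
      have h1 := (memLp_of_mem_polySpace v.2).coeFn_toLp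
      have h2 : ((ι v : Lp (Euc d) 2 μ) : Euc d → Euc d) =ᵐ[μ] 0 := by
        rw [hv]; exact Lp.coeFn_zero _ _ _
      exact h1.symm.trans h2
    apply Subtype.ext
    refine eq_zero_of_eqOn_ball v.2 ?_
    exact Measure.eqOn_open_of_ae_eq h0 Metric.isOpen_ball
      (continuous_of_mem_polySpace v.2).continuousOn continuousOn_const
  -- `G` sends the L² class of a field to its restriction to the larger ball. It is bounded because
  -- its domain is finite-dimensional; the `+ 1` below only makes the constant positive.
  let e := LinearEquiv.ofInjective ι hι
  let G := LinearMap.toContinuousLinearMap (S ∘ₗ e.symm.toLinearMap)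
  refine ⟨‖G‖ ^ 2 + 1, by positivity, fun v hv x hx => ?_⟩
  have h1 : ‖v x‖ ≤ ‖G‖ * ‖ι ⟨v, hv⟩‖ := by
    have h2 : G (e ⟨v, hv⟩) = S ⟨v, hv⟩ := by simp [G]
    calc ‖v x‖ = ‖S ⟨v, hv⟩ ⟨x, hx⟩‖ := rfl
      _ ≤ ‖S ⟨v, hv⟩‖ := ContinuousMap.norm_coe_le_norm _ _
      _ ≤ ‖G‖ * ‖e ⟨v, hv⟩‖ := h2 ▸ G.le_opNorm _
      _ = ‖G‖ * ‖ι ⟨v, hv⟩‖ := rfl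
  have h3 : ‖ι ⟨v, hv⟩‖ ^ 2 = ∫ y in Metric.ball (0 : Euc d) 1, ‖v y‖ ^ 2 := by
    rw [← real_inner_self_eq_norm_sq, L2.inner_def]
    refine integral_congr_ae ?_
    filter_upwards [(memLp_of_mem_polySpace hv).coeFn_toLp] with y hy
    rw [← hy, real_inner_self_eq_norm_sq]
    rfl
  rw [← h3]
  calc ‖v x‖ ^ 2 ≤ (‖G‖ * ‖ι ⟨v, hv⟩‖) ^ 2 := by gcongr
    _ ≤ (‖G‖ ^ 2 + 1) * ‖ι ⟨v, hv⟩‖ ^ 2 := by nlinarith [sq_nonneg ‖ι ⟨v, hv⟩‖]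

/-- The scaled version of `exists_sup_le_integral_unitBall`. -/
theorem exists_sup_le_integral_ball (d k : ℕ) (R : ℝ) :
    ∃ C : ℝ, 0 < C ∧ ∀ v ∈ polySpace d k, ∀ (c : Euc d) (r : ℝ), 0 < r →
      ∀ x ∈ Metric.closedBall c (R * r),
        ‖v x‖ ^ 2 ≤ C * (r ^ d)⁻¹ * ∫ y in Metric.ball c r, ‖v y‖ ^ 2 := by
  obtain ⟨C, hC, h⟩ := exists_sup_le_integral_unitBall d k R
  refine ⟨C, hC, fun v hv c r hr x hx => ?_⟩
  have hx' : r⁻¹ • (x - c) ∈ Metric.closedBall (0 : Euc d) R := by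
    rw [mem_closedBall_zero_iff, norm_smul, norm_inv, Real.norm_of_nonneg hr.le,
      inv_mul_le_iff₀ hr, mul_comm]
    simpa [dist_eq_norm] using hx
  have := h _ (comp_affine_mem_polySpace hv c r) _ hx'
  rw [smul_inv_smul₀ hr.ne', add_sub_cancel] at this
  refine this.trans_eq ?_
  rw [mul_assoc]
  congr 1
  -- The factor r⁻ᵈ is the Jacobian of the scaling; translation preserves the measure.
  have hs := Measure.setIntegral_comp_smul_of_pos (volume : Measure (Euc d))
    (fun y => ‖v (c + y)‖ ^ 2) (Metric.ball (0 : Euc d) 1) hr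
  rw [hs, smul_unitBall hr.ne', Real.norm_of_nonneg hr.le, finrank_euclideanSpace_fin,
    smul_eq_mul]
  congr 1
  have ht := (measurePreserving_add_left (volume : Measure (Euc d)) c).setIntegral_preimage_emb
    (measurableEmbedding_addLeft c) (fun y => ‖v y‖ ^ 2) (Metric.ball c r)
  rw [← ht]
  congr 2
  simp

end PolynomialFields

/-! ### Surface measure of simplices. -/

section FacetMeasure

variable {d : ℕ}

/-- The surface measure of a `(d - 1)`-simplex is bounded by a power of any bound for its
diameter. -/
theorem exists_measure_hull_le (d : ℕ) : ∃ A : ℝ, 0 < A ∧ ∀ (F : Finset (Euc d)) (h : ℝ),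
    0 ≤ h → F.Nonempty → F.card = d → AffineIndependent ℝ ((↑) : F → Euc d) →
      (∀ x ∈ hull F, ∀ y ∈ hull F, dist x y ≤ h) →
        (μHE[d - 1] : Measure (Euc d)) (hull F) ≤ ENNReal.ofReal (A * h ^ (d - 1)) := by
  refine ⟨(volume : Measure (Euc (d - 1))).real (Metric.ball 0 1),
    ENNReal.toReal_pos (Metric.measure_ball_pos _ _ one_pos).ne' measure_ball_lt_top.ne,
    fun F h hh hF hcard hind hdist => ?_⟩
  obtain ⟨p, hp⟩ := hF
  have hpF : p ∈ hull F := subset_convexHull ℝ _ hp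
  have hrank : Module.finrank ℝ (vectorSpan ℝ (F : Set (Euc d))) = d - 1 := by
    have hd : 0 < F.card := Finset.card_pos.2 ⟨p, hp⟩
    have := hind.finrank_vectorSpan (n := d - 1) (by rw [Fintype.card_coe]; omega)
    rwa [Subtype.range_coe_subtype, Finset.setOfPred_mem] at this
  -- The affine span of `F` is an isometric copy of ℝ^(d-1), where `F` lies in the ball of radius h
  -- about its vertex p.
  let e := ((stdOrthonormalBasis ℝ (vectorSpan ℝ (F : Set (Euc d)))).reindex
    (finCongr hrank)).repr.symm
  let g : Euc (d - 1) → Euc d := fun t => p + (e t : Euc d)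
  have hg : Isometry g :=
    (isometry_add_left p).comp (isometry_subtype_coe.comp e.isometry)
  have hsub : hull F ⊆ g '' Metric.closedBall 0 h := by
    intro x hx
    have hx' : x - p ∈ vectorSpan ℝ (F : Set (Euc d)) := by
      rw [← direction_affineSpan]
      exact AffineSubspace.vsub_mem_direction (convexHull_subset_affineSpan _ hx)
        (subset_affineSpan ℝ _ hp)
    refine ⟨e.symm ⟨x - p, hx'⟩, ?_, by simp [g]⟩
    rw [mem_closedBall_zero_iff, LinearIsometryEquiv.norm_map]
    simpa [dist_eq_norm] using hdist x hx p hpF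
  calc (μHE[d - 1] : Measure (Euc d)) (hull F)
      ≤ μHE[d - 1] (g '' Metric.closedBall 0 h) := measure_mono hsub
    _ = volume (Metric.closedBall (0 : Euc (d - 1)) h) := by
        rw [hg.euclideanHausdorffMeasure_image, EuclideanSpace.euclideanHausdorffMeasure_eq_volume]
    _ = ENNReal.ofReal (h ^ (d - 1)) * volume (Metric.ball (0 : Euc (d - 1)) 1) := by
        rw [Measure.addHaar_closedBall _ _ hh, finrank_euclideanSpace_fin]
    _ = _ := by
        rw [mul_comm, ENNReal.ofReal_mul measureReal_nonneg, ofReal_measureReal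
          measure_ball_lt_top.ne]

/-- In edge coordinates at a vertex, the simplex contains the image of a nonempty open set under an
injective linear map, whose volume factor is positive. -/
theorem measure_hull_pos {F : Finset (Euc d)} (hF : F.Nonempty) (hcard : F.card = d)
    (hind : AffineIndependent ℝ ((↑) : F → Euc d)) :
    0 < (μHE[d - 1] : Measure (Euc d)) (hull F) := by
  classical
  obtain ⟨p, hp⟩ := hF
  let ι := {x : F // x ≠ ⟨p, hp⟩}
  have hι : Fintype.card ι = d - 1 := by
    rw [Fintype.card_subtype_compl, Fintype.card_coe, Fintype.card_subtype_eq, hcard]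
  have hlin := (affineIndependent_iff_linearIndependent_vsub ℝ _ (⟨p, hp⟩ : F)).1 hind
  let f : EuclideanSpace ℝ ι →ₗ[ℝ] Euc d :=
    Fintype.linearCombination ℝ (fun i : ι => ((i : F) : Euc d) - p) ∘ₗ
      (WithLp.linearEquiv 2 ℝ (ι → ℝ)).toLinearMap
  have hf : ∀ t, f t = ∑ i, t i • (((i : F) : Euc d) - p) := fun t => rfl
  have hinj : Function.Injective f := by
    have := linearIndependent_iff_injective_fintypeLinearCombination.1 hlin
    exact this.comp (WithLp.linearEquiv 2 ℝ (ι → ℝ)).injective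
  have hdet : 0 < f.normDet := lt_of_le_of_ne f.normDet_nonneg
    (Ne.symm ((f.normDet_ne_zero_tfae.out 0 4).2 hinj))
  let U : Set (EuclideanSpace ℝ ι) := {t | (∀ i, 0 < t i) ∧ ∑ i, t i < 1}
  have hUo : IsOpen U := by
    have h1 : IsOpen {t : EuclideanSpace ℝ ι | ∀ i, 0 < t i} := by
      simp only [Set.ofPred_forall]
      exact isOpen_iInter_of_finite fun i => isOpen_lt continuous_const
        (EuclideanSpace.proj i : EuclideanSpace ℝ ι →L[ℝ] ℝ).continuous
    have h2 : IsOpen {t : EuclideanSpace ℝ ι | ∑ i, t i < 1} :=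
      isOpen_lt (by fun_prop) continuous_const
    exact h1.inter h2
  have hUn : U.Nonempty := by
    refine ⟨WithLp.toLp 2 fun _ => ((Fintype.card ι : ℝ) + 1)⁻¹, fun i => ?_, ?_⟩
    · positivity
    · simp only [Finset.sum_const, Finset.card_univ, nsmul_eq_mul]
      rw [← div_eq_mul_inv, div_lt_one (by positivity)]
      linarith
  have hsub : (fun x => p + x) '' (f '' U) ⊆ hull F := by
    rintro _ ⟨_, ⟨t, ⟨ht0, ht1⟩, rfl⟩, rfl⟩
    -- The index `none` carries the vertex p with the remaining weight 1 - ∑ tᵢ.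
    have := (convex_convexHull ℝ (F : Set (Euc d))).sum_mem (t := Finset.univ)
      (w := fun o : Option ι => o.elim (1 - ∑ i, t i) t)
      (z := fun o : Option ι => o.elim p fun i => ((i : F) : Euc d)) ?_ ?_ ?_
    · convert! this using 1
      simp only [hf, Fintype.sum_option, Option.elim, smul_sub, Finset.sum_sub_distrib, sub_smul,
        one_smul, ← Finset.sum_smul]
      abel
    · rintro (_ | i) -
      · exact sub_nonneg.2 ht1.le
      · exact (ht0 i).le
    · simp [Fintype.sum_option]
    · rintro (_ | i) -
      · exact subset_convexHull ℝ _ hp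
      · exact subset_convexHull ℝ _ i.1.2
  refine lt_of_lt_of_le ?_ (measure_mono hsub)
  have hiso : Isometry fun x : Euc d => p + x := isometry_add_left p
  rw [hiso.euclideanHausdorffMeasure_image]
  have := f.euclideanHausdorffMeasure_image_eq_normDet_mul_volume U
  rw [finrank_euclideanSpace, hι] at this
  rw [this]
  exact ENNReal.mul_pos (by simpa using hdet) (hUo.measure_pos _ hUn).ne'

end FacetMeasure

/-! ### Penalty energies: coercivity, solvability, minimization. -/

section AbstractCondensation

variable {V W : Type*} [AddCommGroup V] [Module ℝ V] [AddCommGroup W] [Module ℝ W]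

/-- Young's inequality for a positive semidefinite symmetric bilinear form. -/
theorem two_mul_le_of_posSemidef (B : W →ₗ[ℝ] W →ₗ[ℝ] ℝ) (hsymm : ∀ x y, B x y = B y x)
    (hpos : ∀ x, 0 ≤ B x x) {s : ℝ} (hs : 0 < s) (x y : W) :
    2 * B x y ≤ s * B x x + s⁻¹ * B y y := by
  have h := hpos (s • x - y)
  simp only [map_sub, map_smul, LinearMap.sub_apply, LinearMap.smul_apply, smul_eq_mul,
    hsymm y x] at h
  have h' : 2 * s * B x y ≤ s * (s * B x x + s⁻¹ * B y y) := by
    rw [mul_add, mul_inv_cancel_left₀ hs.ne']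
    linarith
  exact le_of_mul_le_mul_left (by linarith) hs

/-- A symmetric interior penalty energy is bounded below if the penalty parameter dominates the
constant of the inverse trace inequality. -/
theorem penalty_energy_lower_bound (G : V →ₗ[ℝ] V →ₗ[ℝ] ℝ) (B : W →ₗ[ℝ] W →ₗ[ℝ] ℝ)
    (ν : V →ₗ[ℝ] W) (hBsymm : ∀ x y, B x y = B y x) (hBpos : ∀ x, 0 ≤ B x x)
    {β : ℝ} (hβ : 0 < β) (hν : ∀ v, B (ν v) (ν v) ≤ β / 4 * G v v) (v : V) (x : W) :
    1 / 2 * G v v + β / 2 * B x x ≤ G v v + β * B x x - B x (ν v) - B (ν v) x := by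
  -- The weight β/2 spends half of the penalty; by `hν` the remainder (2/β) B(νv, νv) costs at most
  -- half of G(v, v).
  have h1 := two_mul_le_of_posSemidef B hBsymm hBpos (half_pos hβ) x (ν v)
  have h2 : (β / 2)⁻¹ * B (ν v) (ν v) ≤ 1 / 2 * G v v := by
    rw [inv_mul_le_iff₀ (half_pos hβ)]
    linarith [hν v]
  rw [hBsymm (ν v) x]
  linarith

/-- The local problem of a symmetric interior penalty method has a unique solution, which minimizes
the energy. -/
theorem existsUnique_penalty_solution [FiniteDimensional ℝ V] (G : V →ₗ[ℝ] V →ₗ[ℝ] ℝ)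
    (B : W →ₗ[ℝ] W →ₗ[ℝ] ℝ) (τ ν : V →ₗ[ℝ] W) (hGpos : ∀ v, 0 ≤ G v v)
    (hBsymm : ∀ x y, B x y = B y x) (hBpos : ∀ x, 0 ≤ B x x)
    (hker : ∀ v, G v v = 0 → B (τ v) (τ v) = 0 → v = 0)
    {β : ℝ} (hβ : 0 < β) (hν : ∀ v, B (ν v) (ν v) ≤ β / 4 * G v v) (w : W) :
    ∃! l : V, ∀ z : V, G l z - B (ν l) (τ z) - B (τ l) (ν z) + β * B (τ l) (τ z) =
      - B (ν z) w + β * B (τ z) w := by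
  let a : V →ₗ[ℝ] V →ₗ[ℝ] ℝ :=
    G - B.compl₁₂ ν τ - B.compl₁₂ τ ν + β • B.compl₁₂ τ τ
  have ha : ∀ v z, a v z = G v z - B (ν v) (τ z) - B (τ v) (ν z) + β * B (τ v) (τ z) :=
    fun v z => by simp [a]
  let L : V →ₗ[ℝ] ℝ := - (B.flip w ∘ₗ ν) + β • (B.flip w ∘ₗ τ)
  have hL : ∀ z, L z = - B (ν z) w + β * B (τ z) w := fun z => by simp [L]
  have hinj : Function.Injective a := by
    rw [injective_iff_map_eq_zero]
    intro v hv
    have h0 : a v v = 0 := by rw [hv]; rfl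
    rw [ha] at h0
    -- With x = τv the energy is exactly a(v, v), so a is definite.
    have h1 := penalty_energy_lower_bound G B ν hBsymm hBpos hβ hν v (τ v)
    have h2 := hGpos v
    have h3 := mul_nonneg (half_pos hβ).le (hBpos (τ v))
    refine hker v (by linarith) ?_
    have h4 : β / 2 * B (τ v) (τ v) = 0 := by linarith
    exact (mul_eq_zero.1 h4).resolve_left (half_pos hβ).ne'
  have hsurj : Function.Surjective a :=
    (LinearMap.injective_iff_surjective_of_finrank_eq_finrank
      (Subspace.dual_finrank_eq (K := ℝ) (V := V)).symm).1 hinj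
  obtain ⟨l, hl⟩ := hsurj L
  refine ⟨l, fun z => ?_, fun l' hl' => hinj ?_⟩
  · rw [← ha, ← hL, hl]
  · rw [hl]
    ext z
    rw [ha, hL, hl' z]

/-- Up to a term depending only on w, the energy is a(v, v) - 2L(v), where a and L are the two sides
of the local problem. Its increment from l to l + z is therefore 2(a(l, z) - L(z)) + a(z, z) = a(z,
z) ≥ 0. -/
theorem penalty_energy_le_of_solution (G : V →ₗ[ℝ] V →ₗ[ℝ] ℝ) (B : W →ₗ[ℝ] W →ₗ[ℝ] ℝ)
    (τ ν : V →ₗ[ℝ] W) (hGsymm : ∀ v z, G v z = G z v) (hGpos : ∀ v, 0 ≤ G v v)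
    (hBsymm : ∀ x y, B x y = B y x) (hBpos : ∀ x, 0 ≤ B x x)
    {β : ℝ} (hβ : 0 < β) (hν : ∀ v, B (ν v) (ν v) ≤ β / 4 * G v v) {w : W} {l : V}
    (hl : ∀ z : V, G l z - B (ν l) (τ z) - B (τ l) (ν z) + β * B (τ l) (τ z) =
      - B (ν z) w + β * B (τ z) w) (c : V) :
    G l l + β * B (τ l - w) (τ l - w) - B (τ l - w) (ν l) - B (ν l) (τ l - w) ≤
      G c c + β * B (τ c - w) (τ c - w) - B (τ c - w) (ν c) - B (ν c) (τ c - w) := by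
  obtain ⟨z, rfl⟩ : ∃ z, c = l + z := ⟨c - l, by abel⟩
  have h1 := penalty_energy_lower_bound G B ν hBsymm hBpos hβ hν z (τ z)
  have h2 := hGpos z
  have h3 := mul_nonneg (half_pos hβ).le (hBpos (τ z))
  have h4 := hl z
  simp only [map_add, map_sub, LinearMap.add_apply, LinearMap.sub_apply, hGsymm z l,
    hBsymm (ν l) (τ l), hBsymm (ν z) (τ l), hBsymm (ν l) (τ z), hBsymm (ν z) (τ z),
    hBsymm w, hBsymm (τ z) (τ l)] at h1 h4 ⊢
  linarith

end AbstractCondensation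

/-! ### The forms on a cell as bilinear forms. -/

section CellForms

variable {d k : ℕ} {Ω : Set (Euc d)} {T : Triangulation Ω}

theorem isCompact_hull (s : Finset (Euc d)) : IsCompact (hull s) :=
  s.finite_toSet.isCompact_convexHull (𝕜 := ℝ)

theorem hull_mono {s t : Finset (Euc d)} (h : s ⊆ t) : hull s ⊆ hull t :=
  convexHull_mono (Finset.coe_subset.2 h)

theorem dist_le_size {K : Finset (Euc d)} {x y : Euc d} (hx : x ∈ hull K) (hy : y ∈ hull K) :
    dist x y ≤ size K :=
  Metric.dist_le_diam_of_mem (isCompact_hull K).isBounded hx hy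

theorem Triangulation.mem_facets {F : Finset (Euc d)} :
    F ∈ T.facets ↔ F ∈ T.faces ∧ F.card = d := by
  simp [Triangulation.facets]

theorem Triangulation.mem_cells {K : Finset (Euc d)} :
    K ∈ T.cells ↔ K ∈ T.faces ∧ K.card = d + 1 := by
  simp [Triangulation.cells]

theorem Triangulation.mem_facetsOf {K : T.cells} {F : T.facets} :
    F ∈ T.facetsOf K ↔ F.1 ⊆ K.1 := by
  simp [Triangulation.facetsOf]

theorem Triangulation.facet_nonempty (F : T.facets) : F.1.Nonempty :=
  T.nonempty_of_mem_faces (Triangulation.mem_facets.1 F.2).1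

theorem measure_facet_lt_top (F : T.facets) : (μHE[d - 1] : Measure (Euc d)) (hull F.1) < ⊤ := by
  obtain ⟨A, -, hA⟩ := exists_measure_hull_le d
  obtain ⟨hF, hc⟩ := Triangulation.mem_facets.1 F.2
  exact (hA F.1 (size F.1) Metric.diam_nonneg (Triangulation.facet_nonempty F) hc (T.indep hF)
    fun x hx y hy => dist_le_size hx hy).trans_lt ENNReal.ofReal_lt_top

theorem measure_facet_pos (F : T.facets) :
    0 < (μHE[d - 1] : Measure (Euc d)).real (hull F.1) := by
  obtain ⟨hF, hc⟩ := Triangulation.mem_facets.1 F.2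
  exact ENNReal.toReal_pos (measure_hull_pos (Triangulation.facet_nonempty F) hc (T.indep hF)).ne'
    (measure_facet_lt_top F).ne

theorem integrableOn_facet {E : Type*} [NormedAddCommGroup E] (F : T.facets) {f : Euc d → E}
    (hf : ContinuousOn f (hull F.1)) : IntegrableOn f (hull F.1) μHE[d - 1] := by
  have : IsFiniteMeasure ((μHE[d - 1] : Measure (Euc d)).restrict (hull F.1)) :=
    ⟨by simpa using measure_facet_lt_top F⟩
  -- The surface measure need not be locally finite on ℝ^d, so it is first restricted to the facet,
  -- where it is finite.
  have h := hf.integrableOn_compact (μ := (μHE[d - 1] : Measure (Euc d)).restrict (hull F.1))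
    (isCompact_hull F.1)
  rwa [IntegrableOn, Measure.restrict_restrict (isCompact_hull F.1).measurableSet,
    Set.inter_self] at h

/-- The facet functions that are continuous on each closed facet. -/
def facetCont (T : Triangulation Ω) : Submodule ℝ (T.facets → Euc d → Euc d) where
  carrier := {f | ∀ F, ContinuousOn (f F) (hull F.1)}
  add_mem' hf hg F := (hf F).add (hg F)
  zero_mem' _ := continuousOn_const
  smul_mem' a _ hf F := (hf F).const_smul a

theorem bdryInner_symm (K : T.cells) (f g : T.facets → Euc d → Euc d) :
    bdryInner K f g = bdryInner K g f := by
  simp only [bdryInner, real_inner_comm]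

theorem bdryInner_self_nonneg (K : T.cells) (f : T.facets → Euc d → Euc d) :
    0 ≤ bdryInner K f f :=
  Finset.sum_nonneg fun _ _ => integral_nonneg fun _ => real_inner_self_nonneg

theorem bdryInner_add_left (K : T.cells) {f f' g : T.facets → Euc d → Euc d}
    (hf : f ∈ facetCont T) (hf' : f' ∈ facetCont T) (hg : g ∈ facetCont T) :
    bdryInner K (f + f') g = bdryInner K f g + bdryInner K f' g := by
  simp only [bdryInner, Pi.add_apply, inner_add_left, ← Finset.sum_add_distrib]
  exact Finset.sum_congr rfl fun F _ => integral_add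
    (integrableOn_facet F ((hf F).inner (hg F))) (integrableOn_facet F ((hf' F).inner (hg F)))

theorem bdryInner_smul_left (K : T.cells) (a : ℝ) (f g : T.facets → Euc d → Euc d) :
    bdryInner K (a • f) g = a * bdryInner K f g := by
  simp only [bdryInner, Pi.smul_apply, real_inner_smul_left, integral_const_mul, Finset.mul_sum]

/-- `⟨f, g⟩_{∂K}` as a bilinear form. -/
def bdryForm (K : T.cells) : facetCont T →ₗ[ℝ] facetCont T →ₗ[ℝ] ℝ :=
  LinearMap.mk₂ ℝ (fun f g => bdryInner K f.1 g.1)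
    (fun f f' g => bdryInner_add_left K f.2 f'.2 g.2)
    (fun a f g => bdryInner_smul_left K a f.1 g.1)
    (fun f g g' => by
      simp only [bdryInner_symm K f.1]
      exact bdryInner_add_left K g.2 g'.2 f.2)
    (fun a f g => by
      simp only [bdryInner_symm K f.1]
      exact bdryInner_smul_left K a g.1 f.1)

/-- The trace operator on the local space. -/
def traceMap (T : Triangulation Ω) (k : ℕ) : polySpace d k →ₗ[ℝ] facetCont T where
  toFun v := ⟨trace T v.1, fun _ => (continuous_of_mem_polySpace v.2).continuousOn⟩
  map_add' _ _ := rfl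
  map_smul' _ _ := rfl

theorem differentiableAt_of_mem_polySpace {v : Euc d → Euc d} (hv : v ∈ polySpace d k)
    (x : Euc d) : DifferentiableAt ℝ v x :=
  (contDiff_of_mem_polySpace hv 1).differentiable (by simp) x

/-- The normal derivative on the local space. -/
def normalMap (k : ℕ) (K : T.cells) : polySpace d k →ₗ[ℝ] facetCont T where
  toFun v := ⟨normalDeriv K v.1,
    fun _ => (continuous_of_mem_polySpace (fderiv_mem_polySpace v.2 _)).continuousOn⟩
  map_add' v w := by
    ext1
    funext F x
    simp [normalDeriv, fderiv_add (differentiableAt_of_mem_polySpace v.2 x)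
      (differentiableAt_of_mem_polySpace w.2 x)]
  map_smul' a v := by
    ext1
    funext F x
    simp [normalDeriv, fderiv_const_smul (differentiableAt_of_mem_polySpace v.2 x)]

theorem gradInner_symm (K : T.cells) (v w : Euc d → Euc d) :
    gradInner K v w = gradInner K w v := by
  simp only [gradInner, real_inner_comm]

theorem gradInner_self_nonneg (K : T.cells) (v : Euc d → Euc d) : 0 ≤ gradInner K v v :=
  integral_nonneg fun _ => Finset.sum_nonneg fun _ _ => real_inner_self_nonneg

theorem continuous_gradInner_integrand {v w : Euc d → Euc d} (hv : v ∈ polySpace d k)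
    (hw : w ∈ polySpace d k) : Continuous fun x => ∑ j : Fin d,
      inner ℝ (fderiv ℝ v x (EuclideanSpace.single j 1))
        (fderiv ℝ w x (EuclideanSpace.single j 1)) :=
  continuous_finsetSum _ fun _ _ =>
    (continuous_of_mem_polySpace (fderiv_mem_polySpace hv _)).inner
      (continuous_of_mem_polySpace (fderiv_mem_polySpace hw _))

theorem gradInner_add_left (K : T.cells) {v v' w : Euc d → Euc d} (hv : v ∈ polySpace d k)
    (hv' : v' ∈ polySpace d k) (hw : w ∈ polySpace d k) :
    gradInner K (v + v') w = gradInner K v w + gradInner K v' w := by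
  rw [gradInner, gradInner, gradInner, ← integral_add
    ((continuous_gradInner_integrand hv hw).continuousOn.integrableOn_compact (isCompact_hull _))
    ((continuous_gradInner_integrand hv' hw).continuousOn.integrableOn_compact (isCompact_hull _))]
  refine integral_congr_ae (Filter.Eventually.of_forall fun x => ?_)
  simp [fderiv_add (differentiableAt_of_mem_polySpace hv x)
    (differentiableAt_of_mem_polySpace hv' x), inner_add_left, Finset.sum_add_distrib]

theorem gradInner_smul_left (K : T.cells) (a : ℝ) {v : Euc d → Euc d} (hv : v ∈ polySpace d k)
    (w : Euc d → Euc d) : gradInner K (a • v) w = a * gradInner K v w := by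
  rw [gradInner, gradInner, ← integral_const_mul]
  refine integral_congr_ae (Filter.Eventually.of_forall fun x => ?_)
  simp [fderiv_const_smul (differentiableAt_of_mem_polySpace hv x), real_inner_smul_left,
    Finset.mul_sum]

/-- `(∇v, ∇w)_K` as a bilinear form on the local space. -/
def gradForm (k : ℕ) (K : T.cells) : polySpace d k →ₗ[ℝ] polySpace d k →ₗ[ℝ] ℝ :=
  LinearMap.mk₂ ℝ (fun v w => gradInner K v.1 w.1)
    (fun v v' w => gradInner_add_left K v.2 v'.2 w.2)
    (fun a v w => gradInner_smul_left K a v.2 w.1)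
    (fun v w w' => by
      simp only [gradInner_symm K v.1]
      exact gradInner_add_left K w.2 w'.2 v.2)
    (fun a v w => by
      simp only [gradInner_symm K v.1]
      exact gradInner_smul_left K a w.2 v.1)

theorem mem_facetCont_of_mem_facetSpace {w : T.facets → Euc d → Euc d}
    (hw : w ∈ facetSpace T k) : w ∈ facetCont T := by
  intro F
  obtain ⟨p, hp, h⟩ := hw.1 F
  have hv : (fun x => WithLp.toLp 2 fun i => MvPolynomial.eval (fun j => x j) (p i)) ∈
      polySpace d k := mem_polySpace.2 ⟨p, hp, fun _ _ _ => rfl⟩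
  refine (continuous_of_mem_polySpace hv).continuousOn.congr fun x hx => ?_
  ext i
  exact h x hx i

end CellForms

/-! ### Inverse, trace and Poincaré estimates on shape-regular cells. -/

section CellEstimates

variable {d k : ℕ} {Ω : Set (Euc d)} {T : Triangulation Ω}

theorem size_pos (hd : 1 ≤ d) (K : T.cells) : 0 < size K.1 := by
  have hc := (Triangulation.mem_cells.1 K.2).2
  obtain ⟨x, hx, y, hy, hxy⟩ := Finset.one_lt_card.1 (show 1 < K.1.card by omega)
  exact (dist_pos.2 hxy).trans_le
    (dist_le_size (subset_convexHull ℝ _ hx) (subset_convexHull ℝ _ hy))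

theorem facetsOf_nonempty (hd : 1 ≤ d) (K : T.cells) : (T.facetsOf K).Nonempty := by
  obtain ⟨hK, hc⟩ := Triangulation.mem_cells.1 K.2
  obtain ⟨F, hFK, hF⟩ := Finset.exists_subset_card_eq (show d ≤ K.1.card by omega)
  have hF' : F ∈ T.facets := Triangulation.mem_facets.2
    ⟨T.down_closed hK hFK (Finset.card_pos.1 (by omega)), hF⟩
  exact ⟨⟨F, hF'⟩, Triangulation.mem_facetsOf.2 hFK⟩

/-- Counting all subsets of the vertex set is crude, but any bound depending only on d suffices. -/
theorem card_facetsOf_le (K : T.cells) : (T.facetsOf K).card ≤ 2 ^ (d + 1) := by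
  have hc := (Triangulation.mem_cells.1 K.2).2
  rw [← hc, ← Finset.card_powerset]
  exact Finset.card_le_card_of_injOn (fun F => F.1)
    (fun F hF => Finset.mem_coe.2 (Finset.mem_powerset.2 (Triangulation.mem_facetsOf.1 hF)))
    fun F _ F' _ h => Subtype.ext h

/-- Turns pointwise bounds into L² bounds on ∂K: there are boundedly many facets, each of diameter
at most h_K. -/
theorem exists_bdryInner_self_le (d : ℕ) : ∃ A : ℝ, 0 < A ∧
    ∀ {Ω : Set (Euc d)} {T : Triangulation Ω} (K : T.cells) (f : T.facets → Euc d → Euc d) (M : ℝ),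
      0 ≤ M → (∀ F ∈ T.facetsOf K, ∀ x ∈ hull F.1, ‖f F x‖ ^ 2 ≤ M) →
        bdryInner K f f ≤ A * size K.1 ^ (d - 1) * M := by
  obtain ⟨A, hA, h⟩ := exists_measure_hull_le d
  refine ⟨2 ^ (d + 1) * A, by positivity, fun {Ω T} K f M hM hf => ?_⟩
  have hsize : 0 ≤ size K.1 := Metric.diam_nonneg
  have hterm : ∀ F ∈ T.facetsOf K, ∫ x in hull F.1, inner ℝ (f F x) (f F x) ∂μHE[d - 1] ≤
      A * size K.1 ^ (d - 1) * M := by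
    intro F hF
    have hsub := Triangulation.mem_facetsOf.1 hF
    obtain ⟨hF1, hF2⟩ := Triangulation.mem_facets.1 F.2
    have h1 := norm_setIntegral_le_of_norm_le_const (μ := (μHE[d - 1] : Measure (Euc d)))
      (f := fun x => inner ℝ (f F x) (f F x)) (C := M) (measure_facet_lt_top F)
      fun x hx => by simpa using hf F hF x hx
    have h2 : (μHE[d - 1] : Measure (Euc d)).real (hull F.1) ≤ A * size K.1 ^ (d - 1) :=
      ENNReal.toReal_le_of_le_ofReal (by positivity)
        (h F.1 (size K.1) hsize (Triangulation.facet_nonempty F) hF2 (T.indep hF1)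
          fun x hx y hy => dist_le_size (hull_mono hsub hx) (hull_mono hsub hy))
    calc _ ≤ M * (μHE[d - 1] : Measure (Euc d)).real (hull F.1) := (Real.le_norm_self _).trans h1
      _ ≤ M * (A * size K.1 ^ (d - 1)) := by gcongr
      _ = _ := mul_comm _ _
  calc bdryInner K f f ≤ (T.facetsOf K).card • (A * size K.1 ^ (d - 1) * M) :=
        Finset.sum_le_card_nsmul _ _ _ hterm
    _ = (T.facetsOf K).card * (A * size K.1 ^ (d - 1) * M) := nsmul_eq_mul _ _
    _ ≤ 2 ^ (d + 1) * (A * size K.1 ^ (d - 1) * M) := by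
        gcongr
        exact_mod_cast card_facetsOf_le K
    _ = _ := by ring

theorem setIntegral_norm_sq_ball_le {v : Euc d → Euc d} (hv : v ∈ polySpace d k)
    {K : Finset (Euc d)} {c : Euc d} {r : ℝ} (h : Metric.closedBall c r ⊆ hull K) :
    ∫ y in Metric.ball c r, ‖v y‖ ^ 2 ≤ ∫ y in hull K, ‖v y‖ ^ 2 := by
  refine setIntegral_mono_set ?_ (Filter.Eventually.of_forall fun y => by positivity)
    (Metric.ball_subset_closedBall.trans h).eventuallyLE
  exact ((continuous_of_mem_polySpace hv).norm.pow 2).continuousOn.integrableOn_compact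
    (isCompact_hull K)

/-- The inverse inequality between the maximum and the `L²` norm on shape-regular cells. -/
theorem exists_sup_le_setIntegral_cell (d k : ℕ) (hd : 1 ≤ d) (σ : ℝ) : ∃ C : ℝ, 0 ≤ C ∧
    ∀ {Ω : Set (Euc d)} {T : Triangulation Ω}, T.ShapeRegular σ → ∀ K : T.cells,
      ∀ v ∈ polySpace d k, ∀ x ∈ hull K.1,
        size K.1 ^ d * ‖v x‖ ^ 2 ≤ C * ∫ y in hull K.1, ‖v y‖ ^ 2 := by
  -- Since h_K ≤ 2σr and the centre c lies in K, the ball of radius 2σr about c contains K.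
  obtain ⟨C, hC, h⟩ := exists_sup_le_integral_ball d k (2 * σ)
  -- The sign of σ is known only once a cell is given, hence the absolute value.
  refine ⟨|2 * σ| ^ d * C, by positivity, fun {Ω T} hT K v hv x hx => ?_⟩
  obtain ⟨c, r, hr, hball, hle⟩ := hT K.1 K.2
  have hle' : size K.1 ≤ 2 * σ * r := by linarith
  have hpos := size_pos hd K
  have hσ : 0 ≤ 2 * σ := (pos_of_mul_pos_left (hpos.trans_le hle') hr.le).le
  have hxc : x ∈ Metric.closedBall c (2 * σ * r) :=
    (dist_le_size hx (hball (Metric.mem_closedBall_self hr.le))).trans hle'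
  have h1 := h v hv c r hr x hxc
  have hI : 0 ≤ ∫ y in Metric.ball c r, ‖v y‖ ^ 2 := integral_nonneg fun _ => by positivity
  rw [abs_of_nonneg hσ]
  calc size K.1 ^ d * ‖v x‖ ^ 2
      ≤ (2 * σ * r) ^ d * (C * (r ^ d)⁻¹ * ∫ y in Metric.ball c r, ‖v y‖ ^ 2) := by
        gcongr
    _ = (2 * σ) ^ d * C * ∫ y in Metric.ball c r, ‖v y‖ ^ 2 := by
        rw [mul_pow]
        field_simp
    _ ≤ _ := by
        gcongr ?_ * ?_
        exact setIntegral_norm_sq_ball_le hv hball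

theorem eq_zero_of_setIntegral_eq_zero {v : Euc d → Euc d} (hv : v ∈ polySpace d k)
    {K : Finset (Euc d)} {c : Euc d} {r : ℝ} (hr : 0 < r) (h : Metric.closedBall c r ⊆ hull K)
    (h0 : ∫ y in hull K, ‖v y‖ ^ 2 = 0) (x : Euc d) : v x = 0 := by
  -- The ratio R is taken so large that the enlarged ball reaches x.
  obtain ⟨C, hC, hsup⟩ := exists_sup_le_integral_ball d k (dist x c / r)
  have h1 := hsup v hv c r hr x (by simp [div_mul_cancel₀ _ hr.ne'])
  have h2 := setIntegral_norm_sq_ball_le hv h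
  have h3 : 0 ≤ ∫ y in Metric.ball c r, ‖v y‖ ^ 2 := integral_nonneg fun _ => by positivity
  rw [show ∫ y in Metric.ball c r, ‖v y‖ ^ 2 = 0 by linarith, mul_zero] at h1
  exact norm_eq_zero.1 (pow_eq_zero_iff two_ne_zero |>.1 (le_antisymm h1 (by positivity)))

theorem gradInner_self_eq_sum (K : T.cells) {v : Euc d → Euc d} (hv : v ∈ polySpace d k) :
    gradInner K v v =
      ∑ j : Fin d, ∫ x in hull K.1, ‖fderiv ℝ v x (EuclideanSpace.single j 1)‖ ^ 2 := by
  simp only [gradInner, real_inner_self_eq_norm_sq]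
  exact integral_finsetSum _ fun j _ => ((continuous_of_mem_polySpace
    (fderiv_mem_polySpace hv _)).norm.pow 2).continuousOn.integrableOn_compact (isCompact_hull _)

theorem norm_apply_sq_le_sum (L : Euc d →L[ℝ] Euc d) (n : Euc d) :
    ‖L n‖ ^ 2 ≤ ‖n‖ ^ 2 * ∑ j : Fin d, ‖L (EuclideanSpace.single j 1)‖ ^ 2 := by
  have hn : L n = ∑ j, n j • L (EuclideanSpace.single j 1) := by
    conv_lhs => rw [← (EuclideanSpace.basisFun (Fin d) ℝ).sum_repr n]
    simp
  have h1 : ‖L n‖ ≤ ∑ j, ‖n j‖ * ‖L (EuclideanSpace.single j 1)‖ := by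
    rw [hn]
    exact (norm_sum_le _ _).trans_eq (Finset.sum_congr rfl fun j _ => norm_smul _ _)
  rw [EuclideanSpace.norm_sq_eq n]
  exact (pow_le_pow_left₀ (norm_nonneg _) h1 2).trans (Finset.sum_mul_sq_le_sq_mul_sq _ _ _)

/-- The inequality holds even for ν = 0, so nondegeneracy of the normal need not be checked. -/
theorem norm_outwardNormal_le_one (K F : Finset (Euc d)) : ‖outwardNormal K F‖ ≤ 1 := by
  simp only [outwardNormal, norm_smul, norm_inv, norm_norm]
  exact inv_mul_le_one

/-- The partial derivatives are again in [P_k]^d, so the inverse inequality applies to each of them.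
-/
theorem exists_grad_sup_le (d k : ℕ) (hd : 1 ≤ d) (σ : ℝ) : ∃ C : ℝ, 0 ≤ C ∧
    ∀ {Ω : Set (Euc d)} {T : Triangulation Ω}, T.ShapeRegular σ → ∀ K : T.cells,
      ∀ v ∈ polySpace d k, ∀ x ∈ hull K.1, ∀ n : Euc d,
        ‖fderiv ℝ v x n‖ ^ 2 ≤ ‖n‖ ^ 2 * (C * (size K.1 ^ d)⁻¹ * gradInner K v v) := by
  obtain ⟨C, hC, h⟩ := exists_sup_le_setIntegral_cell d k hd σ
  refine ⟨C, hC, fun {Ω T} hT K v hv x hx n => ?_⟩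
  have hpos := size_pos hd K
  refine (norm_apply_sq_le_sum _ n).trans ?_
  gcongr
  rw [gradInner_self_eq_sum K hv, mul_comm C, mul_assoc, ← div_eq_inv_mul,
    le_div_iff₀ (by positivity), mul_comm, Finset.mul_sum, Finset.mul_sum]
  exact Finset.sum_le_sum fun j _ => h hT K _ (fderiv_mem_polySpace hv _) x hx

/-- The inverse trace inequality for the normal derivative. -/
theorem exists_bdryInner_normalDeriv_le (d k : ℕ) (hd : 1 ≤ d) (σ : ℝ) : ∃ C : ℝ, 0 ≤ C ∧
    ∀ {Ω : Set (Euc d)} {T : Triangulation Ω}, T.ShapeRegular σ → ∀ K : T.cells,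
      ∀ v ∈ polySpace d k,
        bdryInner K (normalDeriv K v) (normalDeriv K v) ≤ C * (size K.1)⁻¹ * gradInner K v v := by
  obtain ⟨C, hC, h⟩ := exists_grad_sup_le d k hd σ
  obtain ⟨A, hA, hB⟩ := exists_bdryInner_self_le d
  refine ⟨A * C, by positivity, fun {Ω T} hT K v hv => ?_⟩
  have hpos := size_pos hd K
  have hG := gradInner_self_nonneg K v
  have hM : 0 ≤ C * (size K.1 ^ d)⁻¹ * gradInner K v v := by positivity
  refine (hB K _ _ hM fun F hF x hx => ?_).trans_eq ?_
  · have hx' := hull_mono (Triangulation.mem_facetsOf.1 hF) hx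
    refine (h hT K v hv x hx' _).trans (mul_le_of_le_one_left hM ?_)
    exact pow_le_one₀ (norm_nonneg _) (norm_outwardNormal_le_one _ _)
  -- The powers combine as h^(d-1) h^(-d) = h⁻¹.
  · obtain ⟨m, rfl⟩ : ∃ m, d = m + 1 := ⟨d - 1, by omega⟩
    rw [Nat.add_sub_cancel]
    field_simp
    ring

/-- A Poincaré inequality on the boundary of a shape-regular cell. -/
theorem exists_bdryInner_sub_const_le (d k : ℕ) (hd : 1 ≤ d) (σ : ℝ) : ∃ C : ℝ, 0 ≤ C ∧
    ∀ {Ω : Set (Euc d)} {T : Triangulation Ω}, T.ShapeRegular σ → ∀ K : T.cells,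
      ∀ v ∈ polySpace d k, ∃ c : Euc d,
        bdryInner K (fun _ x => v x - c) (fun _ x => v x - c) ≤
          C * size K.1 * gradInner K v v := by
  obtain ⟨C, hC, h⟩ := exists_grad_sup_le d k hd σ
  obtain ⟨A, hA, hB⟩ := exists_bdryInner_self_le d
  refine ⟨A * C, by positivity, fun {Ω T} hT K v hv => ?_⟩
  have hpos := size_pos hd K
  have hG := gradInner_self_nonneg K v
  obtain ⟨c, hc⟩ : K.1.Nonempty := T.nonempty_of_mem_faces (Triangulation.mem_cells.1 K.2).1
  have hcK : c ∈ hull K.1 := subset_convexHull ℝ _ hc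
  set S := C * (size K.1 ^ d)⁻¹ * gradInner K v v with hS
  have hS0 : 0 ≤ S := by positivity
  -- The constant is the value of v at a vertex. The mean value inequality on the convex cell gives
  -- |v(x) - v(c)|² ≤ S h², and h^(d-1) h² h^(-d) = h.
  refine ⟨v c, (hB K _ (S * size K.1 ^ 2) (by positivity) fun F hF x hx => ?_).trans_eq ?_⟩
  · have hx' := hull_mono (Triangulation.mem_facetsOf.1 hF) hx
    have hbd : ∀ y ∈ hull K.1, ‖fderiv ℝ v y‖ ≤ √S := fun y hy => by
      refine ContinuousLinearMap.opNorm_le_bound _ (Real.sqrt_nonneg _) fun n => ?_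
      refine le_of_sq_le_sq ?_ (by positivity)
      rw [mul_pow, Real.sq_sqrt hS0, mul_comm]
      exact h hT K v hv y hy n
    have h1 := (convex_convexHull ℝ (K.1 : Set (Euc d))).norm_image_sub_le_of_norm_fderiv_le
      (fun y _ => differentiableAt_of_mem_polySpace hv y) hbd hcK hx'
    have h2 : ‖x - c‖ ≤ size K.1 := by
      rw [← dist_eq_norm]
      exact dist_le_size hx' hcK
    calc ‖v x - v c‖ ^ 2 ≤ (√S * size K.1) ^ 2 := by
          refine pow_le_pow_left₀ (norm_nonneg _) (h1.trans ?_) 2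
          gcongr
      _ = S * size K.1 ^ 2 := by rw [mul_pow, Real.sq_sqrt hS0]
  · obtain ⟨m, rfl⟩ : ∃ m, d = m + 1 := ⟨d - 1, by omega⟩
    rw [Nat.add_sub_cancel, hS]
    field_simp
    ring

/-- A vanishing gradient makes v constant, and the trace on one facet of positive measure fixes the
constant as zero. -/
theorem eq_zero_of_gradInner_eq_zero (hd : 1 ≤ d) {σ : ℝ} (hT : T.ShapeRegular σ) (K : T.cells)
    {v : Euc d → Euc d} (hv : v ∈ polySpace d k) (hG : gradInner K v v = 0)
    (hB : bdryInner K (trace T v) (trace T v) = 0) : v = 0 := by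
  obtain ⟨c, r, hr, hball, -⟩ := hT K.1 K.2
  rw [gradInner_self_eq_sum K hv, Finset.sum_eq_zero_iff_of_nonneg
    fun j _ => integral_nonneg fun _ => by positivity] at hG
  have hz : ∀ x, fderiv ℝ v x = 0 := fun x => by
    ext1 n
    have h := norm_apply_sq_le_sum (fderiv ℝ v x) n
    rw [Finset.sum_eq_zero fun j hj => by
      rw [eq_zero_of_setIntegral_eq_zero (fderiv_mem_polySpace hv _) hr hball (hG j hj) x]
      simp, mul_zero] at h
    simpa using le_antisymm h (by positivity)
  have hconst := is_const_of_fderiv_eq_zero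
    (fun x => differentiableAt_of_mem_polySpace hv x) hz
  obtain ⟨F, hF⟩ := facetsOf_nonempty hd K
  rw [bdryInner, Finset.sum_eq_zero_iff_of_nonneg
    fun F _ => integral_nonneg fun _ => real_inner_self_nonneg] at hB
  have h0 := hB F hF
  have hv0 : v = fun _ => v 0 := funext fun x => hconst x 0
  rw [hv0] at h0 ⊢
  simp only [trace, setIntegral_const, real_inner_self_eq_norm_sq, smul_eq_mul, mul_eq_zero,
    (measure_facet_pos F).ne', false_or] at h0
  funext x
  simpa using h0

theorem const_mem_facetCont (c : Euc d) : (fun _ _ => c) ∈ facetCont T :=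
  fun _ => continuousOn_const

/-- The mean over `∂K` is the best constant approximation. -/
theorem bdryInner_sub_bdryMean_le (hd : 1 ≤ d) (K : T.cells) {w : T.facets → Euc d → Euc d}
    (hw : w ∈ facetCont T) (c : Euc d) :
    bdryInner K (fun F x => w F x - bdryMean K w) (fun F x => w F x - bdryMean K w) ≤
      bdryInner K (fun F x => w F x - c) (fun F x => w F x - c) := by
  set m := bdryMean K w with hm
  have hmem : (fun F x => w F x - m) ∈ facetCont T :=
    (facetCont T).sub_mem hw (const_mem_facetCont m)
  -- Orthogonality of w - m to constants; the claim is then Pythagoras for w - c = (m - c) + (w -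
  -- m).
  have horth : ∀ e : Euc d, bdryInner K (fun _ _ => e) (fun F x => w F x - m) = 0 := fun e => by
    have hpos : 0 < ∑ F ∈ T.facetsOf K, (μHE[d - 1] : Measure (Euc d)).real (hull F.1) :=
      Finset.sum_pos (fun F _ => measure_facet_pos F) (facetsOf_nonempty hd K)
    have h1 : ∀ F : T.facets, ∫ x in hull F.1, inner ℝ e (w F x - m) ∂μHE[d - 1] =
        inner ℝ e (∫ x in hull F.1, w F x ∂μHE[d - 1] -
          (μHE[d - 1] : Measure (Euc d)).real (hull F.1) • m) := fun F => by
      rw [integral_inner (integrableOn_facet F (hmem F)),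
        integral_sub (integrableOn_facet F (hw F)) (integrableOn_facet F continuousOn_const),
        setIntegral_const]
    simp only [bdryInner, h1]
    rw [← inner_sum, Finset.sum_sub_distrib, ← Finset.sum_smul, hm, bdryMean,
      smul_inv_smul₀ hpos.ne', sub_self, inner_zero_right]
  let B := bdryForm K
  let f : facetCont T := ⟨_, hmem⟩
  let g : facetCont T := ⟨_, const_mem_facetCont (m - c)⟩
  have hfg : bdryInner K (fun F x => w F x - c) (fun F x => w F x - c) = B (g + f) (g + f) := by
    change _ = bdryInner K (fun F x => (m - c) + (w F x - m)) (fun F x => (m - c) + (w F x - m))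
    congr 1 <;> funext F x <;> abel
  have h0 : B g f = 0 := horth _
  have h0' : B f g = 0 := (bdryInner_symm K _ _).trans (horth _)
  have hg : 0 ≤ B g g := bdryInner_self_nonneg K _
  have hf : bdryInner K (fun F x => w F x - m) (fun F x => w F x - m) = B f f := rfl
  rw [hfg, hf]
  simp only [map_add, LinearMap.add_apply, h0, h0']
  linarith

end CellEstimates

/-! ### Two-sided bounds for the energy of one cell. -/

section CondensedForm

variable {d k : ℕ} {Ω : Set (Euc d)} {T : Triangulation Ω}

/-- The contribution of the cell `K` to `a_h((v, w), (v, w))`. -/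
def cellEnergy (α : ℝ) (K : T.cells) (v : Euc d → Euc d) (w : T.facets → Euc d → Euc d) : ℝ :=
  gradInner K v v
    + α * (size K.1)⁻¹ * bdryInner K (trace T v - w) (trace T v - w)
    - bdryInner K (trace T v - w) (normalDeriv K v)
    - bdryInner K (normalDeriv K v) (trace T v - w)

/-- The inverse trace inequality on the cell `K`, with a constant dominated by the penalty
parameter `α`. -/
def IsStable (k : ℕ) (α : ℝ) (K : T.cells) : Prop :=
  ∀ v ∈ polySpace d k, bdryInner K (normalDeriv K v) (normalDeriv K v) ≤
    α * (size K.1)⁻¹ / 4 * gradInner K v v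

theorem existsUnique_isLocalSolution (hd : 1 ≤ d) {σ α : ℝ} (hT : T.ShapeRegular σ) (hα : 0 < α)
    (hstab : ∀ K : T.cells, IsStable k α K) {w : T.facets → Euc d → Euc d}
    (hw : w ∈ facetCont T) : ∃! l : T.cells → Euc d → Euc d, IsLocalSolution T k α w l := by
  have hex := fun K : T.cells => existsUnique_penalty_solution (gradForm k K) (bdryForm K)
    (traceMap T k) (normalMap k K) (fun v => gradInner_self_nonneg K v.1)
    (fun x y => bdryInner_symm K x.1 y.1) (fun x => bdryInner_self_nonneg K x.1)
    (fun v hG hB => Subtype.ext (eq_zero_of_gradInner_eq_zero hd hT K v.2 hG hB))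
    (mul_pos hα (inv_pos.2 (size_pos hd K))) (fun v => hstab K v.1 v.2) ⟨w, hw⟩
  choose l hl huniq using hex
  refine ⟨fun K => (l K).1, ⟨fun K => mem_polySpace.1 (l K).2, fun K z hz =>
    hl K ⟨z, mem_polySpace.2 hz⟩⟩, fun l' hl' => ?_⟩
  funext K
  exact congrArg Subtype.val (huniq K ⟨l' K, mem_polySpace.2 (hl'.1 K)⟩
    fun z => hl'.2 K z.1 (mem_polySpace.1 z.2))

/-- The solution is compared with the constant field m_K(w), for which only the penalty term
survives. -/
theorem cellEnergy_le (hd : 1 ≤ d) {α : ℝ} (hα : 0 < α) {K : T.cells} (hstab : IsStable k α K)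
    {w : T.facets → Euc d → Euc d} (hw : w ∈ facetCont T) {l : T.cells → Euc d → Euc d}
    (hl : IsLocalSolution T k α w l) :
    cellEnergy α K (l K) w ≤ α * ((size K.1)⁻¹ *
      bdryInner K (fun F x => w F x - bdryMean K w) (fun F x => w F x - bdryMean K w)) := by
  have h := penalty_energy_le_of_solution (gradForm k K) (bdryForm K)
    (traceMap T k) (normalMap k K) (fun v z => gradInner_symm K v.1 z.1)
    (fun v => gradInner_self_nonneg K v.1)
    (fun x y => bdryInner_symm K x.1 y.1) (fun x => bdryInner_self_nonneg K x.1)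
    (mul_pos hα (inv_pos.2 (size_pos hd K))) (fun v => hstab v.1 v.2) (w := ⟨w, hw⟩)
    (l := ⟨l K, mem_polySpace.2 (hl.1 K)⟩)
    (fun z => hl.2 K z.1 (mem_polySpace.1 z.2)) ⟨_, const_mem_polySpace (bdryMean K w)⟩
  refine (show cellEnergy α K (l K) w ≤ cellEnergy α K (fun _ => bdryMean K w) w from h).trans_eq ?_
  have h1 : gradInner K (fun _ => bdryMean K w) (fun _ => bdryMean K w) = 0 := by
    simp [gradInner]
  have h2 : normalDeriv K (fun _ => bdryMean K w) = 0 := by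
    funext F x
    simp [normalDeriv]
  have h3 : trace T (fun _ => bdryMean K w) - w = (-1 : ℝ) • fun F x => w F x - bdryMean K w := by
    funext F x
    simp [trace]
  have h4 : ∀ f : T.facets → Euc d → Euc d, bdryInner K f 0 = 0 := fun f => by simp [bdryInner]
  rw [cellEnergy, h1, h2, bdryInner_symm K 0, h4, h3, bdryInner_smul_left,
    bdryInner_symm K _ (_ • _), bdryInner_smul_left]
  ring

theorem le_cellEnergy (hd : 1 ≤ d) {α C : ℝ} (hα : 0 < α) {K : T.cells} (hC : 0 ≤ C)
    (hstab : IsStable k α K) {v : Euc d → Euc d} (hv : v ∈ polySpace d k)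
    (hpoinc : ∃ c : Euc d, bdryInner K (fun _ x => v x - c) (fun _ x => v x - c) ≤
      C * size K.1 * gradInner K v v)
    {w : T.facets → Euc d → Euc d} (hw : w ∈ facetCont T) :
    (size K.1)⁻¹ *
        bdryInner K (fun F x => w F x - bdryMean K w) (fun F x => w F x - bdryMean K w) ≤
      (4 / α + 4 * C) * cellEnergy α K v w := by
  obtain ⟨c, hc⟩ := hpoinc
  have hpos := size_pos hd K
  have hβ : 0 < α * (size K.1)⁻¹ := by positivity
  let τ : facetCont T := traceMap T k ⟨v, hv⟩
  let W : facetCont T := ⟨w, hw⟩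
  let c' : facetCont T := ⟨_, const_mem_facetCont c⟩
  have hE : 1 / 2 * gradInner K v v + α * (size K.1)⁻¹ / 2 * bdryForm K (τ - W) (τ - W) ≤
      cellEnergy α K v w :=
    penalty_energy_lower_bound (gradForm k K) (bdryForm K) (normalMap k K)
      (fun x y => bdryInner_symm K x.1 y.1) (fun x => bdryInner_self_nonneg K x.1)
      hβ (fun v => hstab v.1 v.2) ⟨v, hv⟩ (τ - W)
  have hG := gradInner_self_nonneg K v
  have hx : 0 ≤ bdryForm K (τ - W) (τ - W) := bdryInner_self_nonneg K _
  have hc' : bdryForm K (τ - c') (τ - c') ≤ C * size K.1 * gradInner K v v := hc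
  have h1 : bdryInner K (fun F x => w F x - bdryMean K w) (fun F x => w F x - bdryMean K w) ≤
      bdryForm K (W - c') (W - c') := bdryInner_sub_bdryMean_le hd K hw c
  have h2 : bdryForm K (W - c') (W - c') ≤
      2 * bdryForm K (τ - W) (τ - W) + 2 * bdryForm K (τ - c') (τ - c') := by
    -- From 0 ≤ ‖a + b‖² follows ‖b - a‖² ≤ 2‖a‖² + 2‖b‖².
    have h := bdryInner_self_nonneg K ((τ - W) + (τ - c') : facetCont T).1
    change 0 ≤ bdryForm K ((τ - W) + (τ - c')) ((τ - W) + (τ - c')) at h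
    rw [show W - c' = (τ - c') - (τ - W) by abel]
    simp only [map_add, map_sub, LinearMap.add_apply, LinearMap.sub_apply] at h ⊢
    linarith
  set X := bdryForm K (τ - W) (τ - W)
  set G := gradInner K v v
  have hE0 : 0 ≤ 1 / 2 * G := by positivity
  have hX0 : 0 ≤ α * (size K.1)⁻¹ / 2 * X := by positivity
  calc _ ≤ (size K.1)⁻¹ * (2 * X + 2 * (C * size K.1 * G)) := by
        gcongr
        linarith
    -- The terms are regrouped into the two nonnegative parts of the lower bound `hE`, each at most
    -- the whole energy.
    _ = 4 / α * (α * (size K.1)⁻¹ / 2 * X) + 4 * C * (1 / 2 * G) := by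
        field_simp
        ring
    _ ≤ 4 / α * cellEnergy α K v w + 4 * C * cellEnergy α K v w := by
        gcongr <;> linarith
    _ = _ := by ring

end CondensedForm

end HDG

end

/-! ### Choice of the constants and summation over the cells. -/

theorem mainTheorem7 (d : ℕ) (hd : d = 2 ∨ d = 3) (k : ℕ) (hk : 1 ≤ k) (σ : ℝ) :
    ∃ α₀ : ℝ, 0 < α₀ ∧ ∀ α : ℝ, α₀ ≤ α →
      ∃ C₁ : ℝ, 0 < C₁ ∧ ∃ C₂ : ℝ, 0 < C₂ ∧
        ∀ Ω : Set (HDG.Euc d), HDG.IsPolytopalDomain Ω →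
          ∀ T : HDG.Triangulation Ω, T.ShapeRegular σ →
            ∀ w ∈ HDG.facetSpace T k,
              (∃! l : T.cells → HDG.Euc d → HDG.Euc d, HDG.IsLocalSolution T k α w l) ∧
                C₁ * HDG.facetNormSq T w ≤ HDG.condensedForm T k α w w ∧
                HDG.condensedForm T k α w w ≤ C₂ * HDG.facetNormSq T w := by
  have hd1 : 1 ≤ d := by omega
  obtain ⟨C₀, hC₀, htrace⟩ := HDG.exists_bdryInner_normalDeriv_le d k hd1 σ
  obtain ⟨C, hC, hpoinc⟩ := HDG.exists_bdryInner_sub_const_le d k hd1 σ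
  -- Stability asks for C₀ ≤ α/4; the `+ 1` keeps α₀ positive when C₀ = 0.
  refine ⟨4 * C₀ + 1, by positivity, fun α hα => ?_⟩
  have hα0 : 0 < α := by linarith
  refine ⟨(4 / α + 4 * C)⁻¹, by positivity, α, hα0, fun Ω _ T hT w hw => ?_⟩
  have hstab : ∀ K : T.cells, HDG.IsStable k α K := fun K v hv => by
    refine (htrace hT K v hv).trans ?_
    have hG := HDG.gradInner_self_nonneg K v
    have hs := inv_pos.2 (HDG.size_pos hd1 K)
    gcongr
    nlinarith
  have hwc := HDG.mem_facetCont_of_mem_facetSpace hw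
  have hex := HDG.existsUnique_isLocalSolution hd1 hT hα0 hstab hwc
  -- Existence guarantees that the lifting is a genuine solution and not the default value of
  -- `Classical.epsilon`.
  have hl : HDG.IsLocalSolution T k α w (HDG.localLift T k α w) :=
    Classical.epsilon_spec hex.exists
  have hform : HDG.condensedForm T k α w w =
      ∑ K : T.cells, HDG.cellEnergy α K (HDG.localLift T k α w K) w := rfl
  refine ⟨hex, ?_, ?_⟩
  · rw [inv_mul_le_iff₀ (by positivity), hform, HDG.facetNormSq, Finset.mul_sum]
    refine Finset.sum_le_sum fun K _ => ?_
    have hv := HDG.mem_polySpace.2 (hl.1 K)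
    exact HDG.le_cellEnergy hd1 hα0 hC (hstab K) hv (hpoinc hT K _ hv) hwc
  · rw [hform, HDG.facetNormSq, Finset.mul_sum]
    exact Finset.sum_le_sum fun K _ => HDG.cellEnergy_le hd1 hα0 (hstab K) hwc hl
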